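/- Let $M$ be a smooth real manifold (Hausdorff, paracompact, separable, finite-dimensional) and let $L\subset TM\oplus T^*M$ be a Dirac structure on $M$, i.e. a smooth subbundle that is maximally isotropic for $\langle X+\alpha,Y+\beta\rangle_+=\frac12(\alpha(Y)+\beta(X))$ and involutive for the Dorfman bracket $[X,Y]+\mathcal L_X\beta-\iota_Y d\alpha$. A function $f\in C^\infty(M)$ is admissible, $f\in\mathrm{Adm}(M,L)$, if $X+df\in\Gamma(L)$ for some vector field $X$ (an $L$-Hamiltonian vector field of $f$), and $\{f,g\}_L:=-Xg$ for $f,g\in\mathrm{Adm}(M,L)$. On $M^n$ let $L^{[n]}=L\times\cdots\times L$, and for a function $f$ on $M$ let $f^{[n]}(x_1,\dots,x_n)=\sum_{i=1}^n f(x_i)$. Let $\mathfrak g$ be a finite-dimensional real Lie algebra that is a semidirect sum $\mathfrak g=\mathfrak h\,\overrightarrow\oplus\,\mathfrak p$: $\mathfrak h$ is a Lie subalgebra, $\mathfrak p$ an ideal, and $\mathfrak g=\mathfrak h\oplus\mathfrak p$ as vector spaces. Identify $\mathfrak h^*$ with the annihilator $\mathfrak p^\circ\subset\mathfrak g^*$.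 Let $\phi:\mathfrak g\to\mathrm{Adm}(M,L)$ be a morphism of Lie algebras, with momentum map $\mathbf J_\phi:M\to\mathfrak g^*$, $\langle\mathbf J_\phi(x),v\rangle=\phi(v)(x)$; similarly $\mathbf J_{\phi|_{\mathfrak h}}:M\to\mathfrak h^*$ for the restriction $\phi|_{\mathfrak h}$. A superscript $[s]$ on a momentum map denotes the product of $s$ copies. With $C^\infty(N_1)\,\widehat\otimes\,C^\infty(N_2)=C^\infty(N_1\times N_2)$, let $\Delta:C^\infty(\mathfrak g^*)\to C^\infty(\mathfrak g^*\times\mathfrak g^*)$ and $\varphi:C^\infty(\mathfrak g^*)\to C^\infty(\mathfrak g^*\times\mathfrak h^*)$ be the pull-backs by the addition maps $(\xi_1,\xi_2)\mapsto\xi_1+\xi_2$, and put $\Delta^{[2]}=\Delta$, $\Delta^{[k]}=(\mathrm{id}^{\widehat\otimes(k-2)}\,\widehat\otimes\,\Delta)\circ\Delta^{[k-1]}$ for $k>2$, and $\varphi^{[2]}=\varphi$, $\varphi^{[\ell]}=(\varphi\,\widehat\otimes\,\mathrm{id}^{\widehat\otimes(\ell-2)})\circ\varphi^{[\ell-1]}$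 for $\ell>2$, so that $\varphi^{[\ell]}$ takes values in $C^\infty(\mathfrak g^*\times(\mathfrak h^*)^{\ell-1})$. Let $C\in C^\infty(\mathfrak g^*)$ be a Casimir function, i.e. $\{C,f\}=0$ for every $f\in C^\infty(\mathfrak g^*)$, where $\{f,g\}(\xi)=\langle\xi,[df_\xi,dg_\xi]\rangle$. Then, for all $k,\ell\ge2$: 1. The function $\big(\mathbf J_\phi\times\mathbf J_{\phi|_{\mathfrak h}}^{[\ell-1]}\big)^*\big[\varphi^{[\ell]}(C)\big]$ on $M^\ell$ is admissible for $L^{[\ell]}$, and it Poisson-commutes with $\phi(v)^{[\ell]}$ for every $v\in\mathfrak h$ and with the pull-back of $\phi(u)$ along the projection $M^\ell\to M$ onto the first factor for every $u\in\mathfrak p$ (these functions being admissible too). 2. The function $\big(\mathbf J_\phi^{[k]}\times\mathbf J_{\phi|_{\mathfrak h}}^{[\ell-1]}\big)^*\big[\big(\Delta^{[k]}\,\widehat\otimes\,\mathrm{id}^{\widehat\otimes(\ell-1)}\big)\circ\varphi^{[\ell]}(C)\big]$ on $M^{k+\ell-1}$ is admissible for $L^{[k+\ell-1]}$, and it Poisson-commutes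 with $\phi(v)^{[k+\ell-1]}$ for every $v\in\mathfrak h$ and with the pull-back of $\phi(u)^{[k]}$ along the projection $M^{k+\ell-1}\to M^k$ onto the first $k$ factors for every $u\in\mathfrak p$ (these functions being admissible too). In particular, in each case the function is a constant of motion of every Hamiltonian vector field (with respect to $L^{[\ell]}$, respectively $L^{[k+\ell-1]}$) of the functions it is said to commute with. -/

import Mathlib

open scoped Manifold ContDiff Topology

noncomputable section

namespace DiracGeometry

/-! ### Powers of a manifold -/

section Powers

variable {E : Type*} [NormedAddCommGroup E] [NormedSpace ℝ E]
variable {M : Type*} [TopologicalSpace M] [ChartedSpace E M]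

/-- The product atlas on the power `M ^ n`, written `Fin n → M`, of a manifold `M` modelled on `E`.
It is modelled on `Fin n → E`, and its charts are the products of charts of `M`. -/
instance powChartedSpace (n : ℕ) : ChartedSpace (Fin n → E) (Fin n → M) :=
  piChartedSpace (fun _ : Fin n => E) (fun _ : Fin n => M)

instance powIsManifold (n : ℕ) [IsManifold 𝓘(ℝ, E) ∞ M] :
    IsManifold 𝓘(ℝ, Fin n → E) ∞ (Fin n → M) := by
  apply isManifold_of_contDiffOn
  rintro _ _ ⟨f, hf, rfl⟩ ⟨g, hg, rfl⟩
  have key : ∀ i, ContDiffOn ℝ ∞ (g i ∘ (f i).symm) ((f i).symm.trans (g i)).source := by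
    intro i
    have h := StructureGroupoid.compatible (contDiffGroupoid ∞ 𝓘(ℝ, E))
      (hf i (Set.mem_univ _)) (hg i (Set.mem_univ _))
    rw [contDiffGroupoid, mem_groupoid_of_pregroupoid] at h
    simpa [contDiffPregroupoid] using h.1
  refine contDiffOn_pi.2 fun i => ?_
  refine ((key i).comp (contDiff_apply ℝ E i).contDiffOn ?_)
  intro y hy
  have h1 := hy.1
  refine ⟨h1.1 i (Set.mem_univ _), h1.2 i (Set.mem_univ _)⟩

end Powers

/-! ### The generalised tangent bundle and Dirac structures -/

section Dirac

variable {E : Type*} [NormedAddCommGroup E] [NormedSpace ℝ E]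
variable {M : Type*} [TopologicalSpace M] [ChartedSpace E M]

variable (E) in
/-- The tangent space `T_x M` of a manifold `M` modelled on `E`. -/
abbrev Tan (x : M) : Type _ := TangentSpace 𝓘(ℝ, E) x

variable (E) in
/-- The cotangent space `T_x^* M`. -/
abbrev Cotan (x : M) : Type _ := TangentSpace 𝓘(ℝ, E) x →L[ℝ] ℝ

variable (E) in
/-- The differential `df_x ∈ T_x^* M` of a real function. -/
def diff (f : M → ℝ) (x : M) : Cotan E x := mvfderiv 𝓘(ℝ, E) f x

variable (E) in
/-- Smooth real functions on `M`. -/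
def IsSmoothFun (f : M → ℝ) : Prop := ContMDiff 𝓘(ℝ, E) 𝓘(ℝ, ℝ) ∞ f

/-- `X` is smooth on `U`, as a section of the tangent bundle. -/
def IsSmoothVectorFieldOn [IsManifold 𝓘(ℝ, E) ∞ M] (X : ∀ x : M, Tan E x) (U : Set M) : Prop :=
  ContMDiffOn 𝓘(ℝ, E) 𝓘(ℝ, E).tangent ∞
    (fun x => (Bundle.TotalSpace.mk' E x (X x) : TangentBundle 𝓘(ℝ, E) M)) U

/-- `α` is smooth on `U`, as a section of the cotangent bundle. -/
def IsSmoothOneFormOn [IsManifold 𝓘(ℝ, E) ∞ M] (α : ∀ x : M, Cotan E x) (U : Set M) : Prop :=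
  ContMDiffOn 𝓘(ℝ, E) (𝓘(ℝ, E).prod 𝓘(ℝ, E →L[ℝ] ℝ)) ∞
    (fun x => Bundle.TotalSpace.mk' (E →L[ℝ] ℝ)
      (E := fun x : M => TangentSpace 𝓘(ℝ, E) x →L[ℝ] Bundle.Trivial M ℝ x) x (α x)) U

/-- The pairing `⟨v + a, w + b⟩₊ = (a(w) + b(v)) / 2` on `T_x M ⊕ T_x^* M`. -/
def pairing {x : M} (p q : Tan E x × Cotan E x) : ℝ := (1 / 2) * (p.2 q.1 + q.2 p.1)

/-- Isotropic subspaces of `T_x M ⊕ T_x^* M`. -/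
def IsIsotropic {x : M} (W : Submodule ℝ (Tan E x × Cotan E x)) : Prop :=
  ∀ p ∈ W, ∀ q ∈ W, pairing p q = 0

/-- The one-form `α` read in the preferred chart at `x`, as a map `E → E^*`. -/
def formInChart (α : ∀ x : M, Cotan E x) (x : M) : E → (E →L[ℝ] ℝ) := fun y =>
  (α ((extChartAt 𝓘(ℝ, E) x).symm y)).comp
    ((mfderiv 𝓘(ℝ, E) 𝓘(ℝ, E) (extChartAt 𝓘(ℝ, E) x).symm y).comp
      (NormedSpace.fromTangentSpace y).symm.toContinuousLinearMap)

/-- The contraction `(ι_Y dα)_x = dα_x(Y_x, ·)`, computed in the preferred chart at `x`: if `A` is the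
derivative of the map `E → E^*` representing `α`, then `dα(v, w) = A(v)(w) - A(w)(v)`. -/
def contractExtDeriv (Y : ∀ x : M, Tan E x) (α : ∀ x : M, Cotan E x) (x : M) : Cotan E x :=
  let D : Tan E x →L[ℝ] E := mvfderiv 𝓘(ℝ, E) (extChartAt 𝓘(ℝ, E) x) x
  let A : E →L[ℝ] (E →L[ℝ] ℝ) := fderiv ℝ (formInChart α x) (extChartAt 𝓘(ℝ, E) x x)
  (A (D (Y x))).comp D - ((ContinuousLinearMap.apply ℝ ℝ (D (Y x))).comp A).comp D

/-- The Lie derivative `L_X β = ι_X dβ + d(β(X))` of a one-form. -/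
def lieDerivForm (X : ∀ x : M, Tan E x) (β : ∀ x : M, Cotan E x) (x : M) : Cotan E x :=
  contractExtDeriv X β x + diff E (fun y => β y (X y)) x

/-- The Dorfman bracket `⟦X + α, Y + β⟧ = [X, Y] + L_X β - ι_Y dα`. -/
def dorfman (X : ∀ x : M, Tan E x) (α : ∀ x : M, Cotan E x)
    (Y : ∀ x : M, Tan E x) (β : ∀ x : M, Cotan E x) (x : M) : Tan E x × Cotan E x :=
  (VectorField.mlieBracket 𝓘(ℝ, E) X Y x, lieDerivForm X β x - contractExtDeriv Y α x)

/-- `X + α` is a smooth section over `U` of the family `L` of subspaces of `T M ⊕ T^* M`. -/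
structure IsSectionOn [IsManifold 𝓘(ℝ, E) ∞ M]
    (L : ∀ x : M, Submodule ℝ (Tan E x × Cotan E x))
    (X : ∀ x : M, Tan E x) (α : ∀ x : M, Cotan E x) (U : Set M) : Prop where
  smooth_fst : IsSmoothVectorFieldOn X U
  smooth_snd : IsSmoothOneFormOn α U
  mem : ∀ x ∈ U, (X x, α x) ∈ L x

/-- `L` is a Dirac structure on `M`: a smooth subbundle of `T M ⊕ T^* M` (it has smooth local frames)
that is maximally isotropic and involutive under the Dorfman bracket. -/
structure IsDirac [IsManifold 𝓘(ℝ, E) ∞ M]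
    (L : ∀ x : M, Submodule ℝ (Tan E x × Cotan E x)) : Prop where
  maximal_isotropic : ∀ x, Maximal IsIsotropic (L x)
  subbundle : ∀ x₀ : M, ∃ U : Set M, IsOpen U ∧ x₀ ∈ U ∧
    ∃ (m : ℕ) (X : Fin m → ∀ x : M, Tan E x) (α : Fin m → ∀ x : M, Cotan E x),
      (∀ j, IsSectionOn L (X j) (α j) U) ∧
      ∀ x ∈ U, LinearIndependent ℝ (fun j => (X j x, α j x)) ∧
        Submodule.span ℝ (Set.range fun j => (X j x, α j x)) = L x
  involutive : ∀ X α Y β, IsSectionOn L X α Set.univ → IsSectionOn L Y β Set.univ →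
    ∀ x, dorfman X α Y β x ∈ L x

/-- `f` is an `L`-Hamiltonian function for the (smooth) vector field `X`: `X + df ∈ Γ(L)`. -/
structure IsHamiltonian [IsManifold 𝓘(ℝ, E) ∞ M]
    (L : ∀ x : M, Submodule ℝ (Tan E x × Cotan E x))
    (X : ∀ x : M, Tan E x) (f : M → ℝ) : Prop where
  smooth_fun : IsSmoothFun E f
  smooth_field : IsSmoothVectorFieldOn X Set.univ
  mem : ∀ x, (X x, diff E f x) ∈ L x

/-- The set `Adm(M, L)` of admissible functions. -/
def Adm [IsManifold 𝓘(ℝ, E) ∞ M] (L : ∀ x : M, Submodule ℝ (Tan E x × Cotan E x)) :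
    Set (M → ℝ) :=
  {f | ∃ X, IsHamiltonian L X f}

open scoped Classical in
/-- The bracket `{f, g}_L = - X g` of admissible functions, where `X` is any `L`-Hamiltonian vector
field of `f`; by `poissonBracket_eq` it does not depend on `X`. -/
def poissonBracket [IsManifold 𝓘(ℝ, E) ∞ M]
    (L : ∀ x : M, Submodule ℝ (Tan E x × Cotan E x)) (f g : M → ℝ) : M → ℝ :=
  if h : ∃ X, IsHamiltonian L X f then fun x => - diff E g x (h.choose x) else 0

theorem poissonBracket_eq [IsManifold 𝓘(ℝ, E) ∞ M]
    {L : ∀ x : M, Submodule ℝ (Tan E x × Cotan E x)} (hL : ∀ x, IsIsotropic (L x))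
    {X : ∀ x : M, Tan E x} {f g : M → ℝ} (hX : IsHamiltonian L X f) (hg : g ∈ Adm L) (x : M) :
    poissonBracket L f g x = - diff E g x (X x) := by
  have h : ∃ X, IsHamiltonian L X f := ⟨X, hX⟩
  obtain ⟨Y, hY⟩ := hg
  rw [poissonBracket, dif_pos h]
  have h1 := hL x _ (h.choose_spec.mem x) _ (hY.mem x)
  have h2 := hL x _ (hX.mem x) _ (hY.mem x)
  simp only [pairing] at h1 h2
  linarith

/-- The diagonal prolongation `L^[n]` to `M ^ n`, i.e. the direct product `L × ⋯ × L`. Tangent vectors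
of `M ^ n` are identified with tuples of tangent vectors through the differentials of the
projections `pr_i`, and a tuple `(a_i)` of covectors is identified with `∑ i, a_i ∘ T pr_i`. -/
def prolongDirac (L : ∀ x : M, Submodule ℝ (Tan E x × Cotan E x)) (n : ℕ) (x : Fin n → M) :
    Submodule ℝ (Tan (Fin n → E) x × Cotan (Fin n → E) x) :=
  let D (i : Fin n) : Tan (Fin n → E) x →L[ℝ] Tan E (x i) :=
    mfderiv 𝓘(ℝ, Fin n → E) 𝓘(ℝ, E) (fun y : Fin n → M => y i) x
  { carrier := {p | ∃ a : ∀ i, Cotan E (x i),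
      (∀ i, (D i p.1, a i) ∈ L (x i)) ∧ p.2 = ∑ i, (a i).comp (D i)}
    zero_mem' := ⟨fun _ => 0, fun i => by
      rw [Prod.fst_zero, map_zero]; exact (L (x i)).zero_mem, by simp⟩
    add_mem' := by
      rintro p q ⟨a, ha, hp⟩ ⟨b, hb, hq⟩
      refine ⟨fun i => a i + b i, fun i => ?_, ?_⟩
      · simpa using (L (x i)).add_mem (ha i) (hb i)
      · simp [hp, hq, ContinuousLinearMap.add_comp, Finset.sum_add_distrib]
    smul_mem' := by
      rintro c p ⟨a, ha, hp⟩
      refine ⟨fun i => c • a i, fun i => ?_, ?_⟩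
      · simpa using (L (x i)).smul_mem c (ha i)
      · simp [hp, ContinuousLinearMap.smul_comp, Finset.smul_sum] }

theorem prolongDirac_isIsotropic {L : ∀ x : M, Submodule ℝ (Tan E x × Cotan E x)}
    (hL : ∀ x, IsIsotropic (L x)) (n : ℕ) (x : Fin n → M) : IsIsotropic (prolongDirac L n x) := by
  rintro p ⟨a, ha, hp⟩ q ⟨b, hb, hq⟩
  have h : ∀ i, _ := fun i => hL (x i) _ (ha i) _ (hb i)
  simp only [pairing] at h ⊢
  rw [hp, hq, sum_apply, sum_apply,
    ← Finset.sum_add_distrib, Finset.mul_sum]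
  exact Finset.sum_eq_zero fun i _ => h i

/-- The diagonal prolongation `f^[n](x_1, …, x_n) = f(x_1) + ⋯ + f(x_n)` of a function. -/
def prolongFun (n : ℕ) (f : M → ℝ) : (Fin n → M) → ℝ := fun x => ∑ i, f (x i)

/-- The pull-back of `F : M ^ r → ℝ` along the projection `M ^ n → M ^ r` onto the first `r`
factors. -/
def liftFun {r n : ℕ} (h : r ≤ n) (F : (Fin r → M) → ℝ) : (Fin n → M) → ℝ :=
  fun x => F (fun i => x (Fin.castLE h i))

/-- `F` and `G` are admissible functions that Poisson-commute, and `F` is a constant of motion of every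
`L`-Hamiltonian vector field with Hamiltonian function `G`. -/
structure PoissonCommute [IsManifold 𝓘(ℝ, E) ∞ M]
    (L : ∀ x : M, Submodule ℝ (Tan E x × Cotan E x)) (F G : M → ℝ) : Prop where
  left_mem : F ∈ Adm L
  right_mem : G ∈ Adm L
  bracket_eq_zero : poissonBracket L F G = 0
  constant_of_motion : ∀ X, IsHamiltonian L X G → ∀ x, diff E F x (X x) = 0

/-! ### Infinitesimal Hamiltonian actions and momentum maps -/

/-- An infinitesimal `L`-Hamiltonian action: a morphism of Lie algebras `𝔨 → Adm(M, L)`. -/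
structure HamiltonianAction [IsManifold 𝓘(ℝ, E) ∞ M] (𝔨 : Type*) [LieRing 𝔨] [LieAlgebra ℝ 𝔨]
    (L : ∀ x : M, Submodule ℝ (Tan E x × Cotan E x)) where
  toLinearMap : 𝔨 →ₗ[ℝ] (M → ℝ)
  mem_adm : ∀ v, toLinearMap v ∈ Adm L
  map_lie : ∀ v w, toLinearMap ⁅v, w⁆ = poissonBracket L (toLinearMap v) (toLinearMap w)

namespace HamiltonianAction

variable [IsManifold 𝓘(ℝ, E) ∞ M] {𝔨 : Type*} [LieRing 𝔨] [LieAlgebra ℝ 𝔨]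
variable {L : ∀ x : M, Submodule ℝ (Tan E x × Cotan E x)}

/-- The restriction of an action to a Lie subalgebra. -/
def restrict (φ : HamiltonianAction 𝔨 L) (𝔥 : LieSubalgebra ℝ 𝔨) : HamiltonianAction 𝔥 L where
  toLinearMap := φ.toLinearMap ∘ₗ 𝔥.toSubmodule.subtype
  mem_adm v := φ.mem_adm v
  map_lie v w := φ.map_lie v w

/-- The momentum map `J_φ : M → 𝔨^*`, `⟨J_φ(x), v⟩ = φ(v)(x)`. -/
def momentum (φ : HamiltonianAction 𝔨 L) (x : M) : Module.Dual ℝ 𝔨 :=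
  LinearMap.proj x ∘ₗ φ.toLinearMap

/-- The product of momentum maps `J_φ^[r] × J_{φ|𝔥}^[s] : M ^ n → (𝔨^*)^r × (𝔥^*)^s`, where
`r + s = n`: the first `r` factors of `M` are mapped by `J_φ`, the others by `J_{φ|𝔥}`. -/
def productMomentum (φ : HamiltonianAction 𝔨 L) (𝔥 : LieSubalgebra ℝ 𝔨) {r s n : ℕ}
    (h : r + s = n) (x : Fin n → M) :
    (Fin r → Module.Dual ℝ 𝔨) × (Fin s → Module.Dual ℝ 𝔥) :=
  (fun i => φ.momentum (x (Fin.cast h (Fin.castAdd s i))),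
    fun j => (φ.restrict 𝔥).momentum (x (Fin.cast h (Fin.natAdd r j))))

end HamiltonianAction

end Dirac

/-! ### The Poisson coalgebra of functions on the dual of a Lie algebra -/

section Coalgebra

/-- A norm on the dual `V^*` of a finite-dimensional real vector space (the sup norm of the
coordinates in a basis). It serves to speak of smooth functions on `V^*`, and any other norm would
give the same smooth functions and derivatives. -/
instance dualNormedAddCommGroup (V : Type*) [AddCommGroup V] [Module ℝ V]
    [FiniteDimensional ℝ V] : NormedAddCommGroup (Module.Dual ℝ V) :=
  NormedAddCommGroup.induced (Module.Dual ℝ V)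
    (Fin (Module.finrank ℝ (Module.Dual ℝ V)) → ℝ)
    (Module.finBasis ℝ (Module.Dual ℝ V)).equivFun.toLinearMap
    (Module.finBasis ℝ (Module.Dual ℝ V)).equivFun.injective

instance dualNormedSpace (V : Type*) [AddCommGroup V] [Module ℝ V]
    [FiniteDimensional ℝ V] : NormedSpace ℝ (Module.Dual ℝ V) :=
  NormedSpace.induced ℝ (Module.Dual ℝ V)
    (Fin (Module.finrank ℝ (Module.Dual ℝ V)) → ℝ)
    (Module.finBasis ℝ (Module.Dual ℝ V)).equivFun.toLinearMap

variable {𝔤 : Type*} [LieRing 𝔤] [LieAlgebra ℝ 𝔤]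

/-- The differential `df_ξ` of a function on `𝔤^*`, as an element of `𝔤 ≃ 𝔤^{**}`. -/
def dualDiff [FiniteDimensional ℝ 𝔤] (f : Module.Dual ℝ 𝔤 → ℝ) (ξ : Module.Dual ℝ 𝔤) : 𝔤 :=
  (Module.evalEquiv ℝ 𝔤).symm (fderiv ℝ f ξ).toLinearMap

/-- The Kirillov–Kostant–Souriau bracket `{f, g}(ξ) = ⟨ξ, [df_ξ, dg_ξ]⟩` on `𝔤^*`. -/
def kksBracket [FiniteDimensional ℝ 𝔤] (f g : Module.Dual ℝ 𝔤 → ℝ) : Module.Dual ℝ 𝔤 → ℝ :=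
  fun ξ => ξ ⁅dualDiff f ξ, dualDiff g ξ⁆

/-- `C ∈ C^∞(𝔤^*)` is a Casimir function. -/
structure IsCasimir [FiniteDimensional ℝ 𝔤] (C : Module.Dual ℝ 𝔤 → ℝ) : Prop where
  smooth : ContDiff ℝ ∞ C
  bracket_eq_zero : ∀ f : Module.Dual ℝ 𝔤 → ℝ, ContDiff ℝ ∞ f → kksBracket C f = 0

/-- The coproduct `Δ = m^*`, `(Δ f)(ξ₁, ξ₂) = f(ξ₁ + ξ₂)`, where functions on products stand for
the elements of completed tensor products. -/
def coproduct (f : Module.Dual ℝ 𝔤 → ℝ) : Module.Dual ℝ 𝔤 × Module.Dual ℝ 𝔤 → ℝ :=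
  fun q => f (q.1 + q.2)

/-- The `k`-th order coproduct `Δ^[k] : C^∞(𝔤^*) → C^∞((𝔤^*)^k)`, with `Δ^[1] = id` and
`Δ^[k + 1] = (id ⊗ ⋯ ⊗ id ⊗ Δ) ∘ Δ^[k]`; the case `k = 0` is not used. -/
def iterCoproduct : (k : ℕ) → (Module.Dual ℝ 𝔤 → ℝ) → (Fin k → Module.Dual ℝ 𝔤) → ℝ
  | 0, f => fun _ => f 0
  | 1, f => fun ξ => f (ξ 0)
  | k + 2, f => fun ξ =>
      coproduct
        (fun ζ => iterCoproduct (k + 1) f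
          (Fin.snoc (fun i : Fin k => ξ i.castSucc.castSucc) ζ : Fin (k + 1) → Module.Dual ℝ 𝔤))
        (ξ (Fin.last k).castSucc, ξ (Fin.last (k + 1)))

/-- The inclusion `𝔥^* ≃ 𝔭° ⊆ 𝔤^*` for a decomposition `𝔤 = 𝔥 ⊕ 𝔭`: a functional on `𝔥` is extended
by `0` on `𝔭`. -/
def dualIncl {𝔥 : LieSubalgebra ℝ 𝔤} {𝔭 : LieIdeal ℝ 𝔤}
    (hc : IsCompl 𝔥.toSubmodule 𝔭.toSubmodule) (η : Module.Dual ℝ 𝔥) : Module.Dual ℝ 𝔤 :=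
  η ∘ₗ Submodule.projectionOnto 𝔥.toSubmodule 𝔭.toSubmodule hc

/-- The coaction `φ : C^∞(𝔤^*) → C^∞(𝔤^* × 𝔥^*)`, the pull-back by `(ξ, η) ↦ ξ + η`. -/
def coaction {𝔥 : LieSubalgebra ℝ 𝔤} {𝔭 : LieIdeal ℝ 𝔤}
    (hc : IsCompl 𝔥.toSubmodule 𝔭.toSubmodule) (f : Module.Dual ℝ 𝔤 → ℝ) :
    Module.Dual ℝ 𝔤 × Module.Dual ℝ 𝔥 → ℝ :=
  fun q => f (q.1 + dualIncl hc q.2)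

/-- The `ℓ`-th order coaction `φ^[ℓ] : C^∞(𝔤^*) → C^∞(𝔤^* × (𝔥^*)^(ℓ - 1))`, with `φ^[1] = id` and
`φ^[ℓ + 1] = (φ ⊗ id ⊗ ⋯ ⊗ id) ∘ φ^[ℓ]`; the case `ℓ = 0` is not used. -/
def iterCoaction {𝔥 : LieSubalgebra ℝ 𝔤} {𝔭 : LieIdeal ℝ 𝔤}
    (hc : IsCompl 𝔥.toSubmodule 𝔭.toSubmodule) :
    (ℓ : ℕ) → (Module.Dual ℝ 𝔤 → ℝ) →
      Module.Dual ℝ 𝔤 × (Fin (ℓ - 1) → Module.Dual ℝ 𝔥) → ℝ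
  | 0, f => fun q => f q.1
  | 1, f => fun q => f q.1
  | ℓ + 2, f => fun q =>
      coaction hc
        (fun ξ => iterCoaction hc (ℓ + 1) f
          (ξ, fun i : Fin ℓ => (q.2 : Fin (ℓ + 1) → Module.Dual ℝ 𝔥) i.succ))
        (q.1, (q.2 : Fin (ℓ + 1) → Module.Dual ℝ 𝔥) (0 : Fin (ℓ + 1)))

/-- The operator `Δ^[k] ⊗ id ⊗ ⋯ ⊗ id : C^∞(𝔤^* × (𝔥^*)^s) → C^∞((𝔤^*)^k × (𝔥^*)^s)`, which applies
`Δ^[k]` in the first variable. -/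
def iterCoproductTensorId {𝔥 : LieSubalgebra ℝ 𝔤} (k s : ℕ)
    (F : Module.Dual ℝ 𝔤 × (Fin s → Module.Dual ℝ 𝔥) → ℝ) :
    (Fin k → Module.Dual ℝ 𝔤) × (Fin s → Module.Dual ℝ 𝔥) → ℝ :=
  fun q => iterCoproduct k (fun ξ => F (ξ, q.2)) q.1

theorem iterCoproduct_two (f : Module.Dual ℝ 𝔤 → ℝ) (ξ : Fin 2 → Module.Dual ℝ 𝔤) :
    iterCoproduct 2 f ξ = coproduct f (ξ 0, ξ 1) := rfl

theorem iterCoaction_two {𝔥 : LieSubalgebra ℝ 𝔤} {𝔭 : LieIdeal ℝ 𝔤}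
    (hc : IsCompl 𝔥.toSubmodule 𝔭.toSubmodule) (f : Module.Dual ℝ 𝔤 → ℝ)
    (q : Module.Dual ℝ 𝔤 × (Fin 1 → Module.Dual ℝ 𝔥)) :
    iterCoaction hc 2 f q = coaction hc f (q.1, q.2 0) := rfl

end Coalgebra

/-! ### The functions of the theorem -/

section MixedConstants

variable {E : Type*} [NormedAddCommGroup E] [NormedSpace ℝ E]
variable {M : Type*} [TopologicalSpace M] [ChartedSpace E M] [IsManifold 𝓘(ℝ, E) ∞ M]
variable {L : ∀ x : M, Submodule ℝ (Tan E x × Cotan E x)}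
variable {𝔤 : Type*} [LieRing 𝔤] [LieAlgebra ℝ 𝔤]
variable {𝔥 : LieSubalgebra ℝ 𝔤} {𝔭 : LieIdeal ℝ 𝔤}

/-- The function `(J_φ × J_{φ|𝔥}^[ℓ - 1])^* (φ^[ℓ] C)` on `M ^ ℓ`. -/
def coactionFun (hc : IsCompl 𝔥.toSubmodule 𝔭.toSubmodule) (φ : HamiltonianAction 𝔤 L)
    (C : Module.Dual ℝ 𝔤 → ℝ) (ℓ : ℕ) (hℓ : 2 ≤ ℓ) : (Fin ℓ → M) → ℝ := fun x =>
  iterCoaction hc ℓ C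
    ((φ.productMomentum 𝔥 (show 1 + (ℓ - 1) = ℓ by omega) x).1 0,
      (φ.productMomentum 𝔥 (show 1 + (ℓ - 1) = ℓ by omega) x).2)

/-- The function `(J_φ^[k] × J_{φ|𝔥}^[ℓ - 1])^* ((Δ^[k] ⊗ id ⊗ ⋯ ⊗ id) (φ^[ℓ] C))` on
`M ^ (k + ℓ - 1)`. -/
def coproductCoactionFun (hc : IsCompl 𝔥.toSubmodule 𝔭.toSubmodule) (φ : HamiltonianAction 𝔤 L)
    (C : Module.Dual ℝ 𝔤 → ℝ) (k ℓ : ℕ) (hℓ : 2 ≤ ℓ) : (Fin (k + ℓ - 1) → M) → ℝ := fun x =>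
  iterCoproductTensorId k (ℓ - 1) (iterCoaction hc ℓ C)
    (φ.productMomentum 𝔥 (show k + (ℓ - 1) = k + ℓ - 1 by omega) x)

end MixedConstants

end DiracGeometry

end

open DiracGeometry

noncomputable section

namespace DiracGeometry

/-! ### Calculus on the power `M ^ n`: projections and product vector fields. -/

section PowerCalculus

variable {E : Type*} [NormedAddCommGroup E] [NormedSpace ℝ E]
variable {M : Type*} [TopologicalSpace M] [ChartedSpace E M]

/-! All four claims are instances of one classical fact: if `J` is the momentum map of a Hamiltonian
action of `𝔤` and `C` is a Casimir, then `C ∘ J` commutes with every Hamiltonian of the action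
(`poissonCommute_comp_momentum`). Indeed `d(C ∘ J)_x` is the differential at `x` of the Hamiltonian
of the element `dC_{J(x)}`, so a combination of the generating fields, with smooth coefficients, is
Hamiltonian for `C ∘ J`. Its derivative of the Hamiltonian of `v` is `-⟨J, [dC_J, v]⟩`, which
vanishes because `C` is a Casimir.

The action to use on `M ^ n` is `mixedProlong`: `φ` on the first `r` factors and `φ` composed with
the projection `𝔤 → 𝔥` along `𝔭` on the others. As `𝔭` is an ideal, this projection is a Lie algebra
morphism (`projLieHom`), so the sum over the factors is again an action for `L^[n]`. It sends `v ∈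
𝔥` to `φ(v)^[n]`, and `u ∈ 𝔭` to the sum of `φ(u)` over the first `r` factors.

The projection is dual to the inclusion `𝔥^* ⊆ 𝔤^*`, so the momentum map of this action is the sum
of the component momentum maps (`mixedProlong_momentum`). Iterated coproducts and coactions are
pull-backs by total addition, so the functions of the theorem are `C` composed with that momentum
map, for `r = 1` and `r = k`. -/

theorem writtenInExtChartAt_eval {n : ℕ} (i : Fin n) (x : Fin n → M) {y : Fin n → E}
    (hy : y ∈ (extChartAt 𝓘(ℝ, Fin n → E) x).target) :
    writtenInExtChartAt 𝓘(ℝ, Fin n → E) 𝓘(ℝ, E) x (fun z : Fin n → M => z i) y = y i := by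
  have h : ∀ j, y j ∈ (chartAt E (x j)).target := by
    have hy' : y ∈ (chartAt (Fin n → E) x).target := by simpa using hy
    exact fun j => hy' j (Set.mem_univ j)
  exact (chartAt E (x i)).right_inv (h i)

theorem writtenInExtChartAt_eval_eventuallyEq {n : ℕ} (i : Fin n) (x : Fin n → M) :
    writtenInExtChartAt 𝓘(ℝ, Fin n → E) 𝓘(ℝ, E) x (fun z : Fin n → M => z i)
      =ᶠ[𝓝 (extChartAt 𝓘(ℝ, Fin n → E) x x)] fun y => y i := by
  filter_upwards [extChartAt_target_mem_nhds (I := 𝓘(ℝ, Fin n → E)) x] with y hy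
  exact writtenInExtChartAt_eval i x hy

/-- In the product charts the projection reads as a linear coordinate projection, which is its own
derivative. -/
theorem hasMFDerivAt_eval {n : ℕ} (i : Fin n) (x : Fin n → M) :
    HasMFDerivAt 𝓘(ℝ, Fin n → E) 𝓘(ℝ, E) (fun z : Fin n → M => z i) x
      (ContinuousLinearMap.proj (R := ℝ) (φ := fun _ : Fin n => E) i) := by
  refine ⟨(continuous_apply i).continuousAt, ?_⟩
  refine HasFDerivAt.hasFDerivWithinAt ?_
  exact (ContinuousLinearMap.proj (R := ℝ) (φ := fun _ : Fin n => E) i).hasFDerivAt.congr_of_eventuallyEq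
    (writtenInExtChartAt_eval_eventuallyEq i x)

theorem contMDiff_eval {n : ℕ} (i : Fin n) :
    ContMDiff 𝓘(ℝ, Fin n → E) 𝓘(ℝ, E) ∞ (fun z : Fin n → M => z i) := by
  intro x
  rw [contMDiffAt_iff]
  refine ⟨(continuous_apply i).continuousAt, ?_⟩
  refine ContDiffAt.contDiffWithinAt ?_
  exact (contDiff_apply ℝ E i).contDiffAt.congr_of_eventuallyEq
    (writtenInExtChartAt_eval_eventuallyEq i x)

/-- The product vector field on `M ^ n`, with components `X i`. -/
def productField {n : ℕ} (X : Fin n → ∀ x : M, Tan E x) (x : Fin n → M) : Tan (Fin n → E) x :=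
  fun i => X i (x i)

theorem mfderiv_eval_productField {n : ℕ} (X : Fin n → ∀ x : M, Tan E x) (x : Fin n → M)
    (i : Fin n) :
    mfderiv 𝓘(ℝ, Fin n → E) 𝓘(ℝ, E) (fun z : Fin n → M => z i) x (productField X x)
      = X i (x i) := by
  rw [(hasMFDerivAt_eval i x).mfderiv]; rfl

variable [IsManifold 𝓘(ℝ, E) ∞ M]

theorem trivializationAt_tangent_snd {x₀ x : M} (hx : x ∈ (chartAt E x₀).source) (v : Tan E x) :
    (trivializationAt E (TangentSpace 𝓘(ℝ, E)) x₀ ⟨x, v⟩).2 =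
      mfderiv 𝓘(ℝ, E) 𝓘(ℝ, E) (extChartAt 𝓘(ℝ, E) x₀) x v := by
  have : IsManifold 𝓘(ℝ, E) 1 M := .of_le (n := ∞) (by simp)
  have h := (trivializationAt E (TangentSpace 𝓘(ℝ, E)) x₀).continuousLinearMapAt_apply_of_mem
    (R := ℝ) (b := x) (by simpa using hx) v
  exact h.symm.trans
    (congrArg (fun A => A v) (TangentBundle.continuousLinearMapAt_trivializationAt hx))

/-- If `π : N → M` reads as the continuous linear map `p` in the preferred charts at `x₀` and `π x₀`,
then its differential reads as `p` in the corresponding trivializations. -/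
theorem map_trivializationAt_tangent_snd {F : Type*} [NormedAddCommGroup F] [NormedSpace ℝ F]
    {N : Type*} [TopologicalSpace N] [ChartedSpace F N] [IsManifold 𝓘(ℝ, F) ∞ N]
    (p : F →L[ℝ] E) {π : N → M} {x₀ x : N}
    (hp : ∀ z, p (extChartAt 𝓘(ℝ, F) x₀ z) = extChartAt 𝓘(ℝ, E) (π x₀) (π z))
    (hx : x ∈ (chartAt F x₀).source) (hπx : π x ∈ (chartAt E (π x₀)).source)
    (hπ : MDifferentiableAt 𝓘(ℝ, F) 𝓘(ℝ, E) π x) (v : Tan F x) :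
    p (trivializationAt F (TangentSpace 𝓘(ℝ, F)) x₀ ⟨x, v⟩).2 =
      (trivializationAt E (TangentSpace 𝓘(ℝ, E)) (π x₀)
        ⟨π x, mfderiv 𝓘(ℝ, F) 𝓘(ℝ, E) π x v⟩).2 := by
  have : IsManifold 𝓘(ℝ, E) 1 M := .of_le (n := ∞) (by simp)
  have : IsManifold 𝓘(ℝ, F) 1 N := .of_le (n := ∞) (by simp)
  rw [trivializationAt_tangent_snd hx, trivializationAt_tangent_snd hπx]
  have h1 : MDifferentiableAt 𝓘(ℝ, F) 𝓘(ℝ, F) (extChartAt 𝓘(ℝ, F) x₀) x :=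
    mdifferentiableAt_extChartAt hx
  have h2 : MDifferentiableAt 𝓘(ℝ, E) 𝓘(ℝ, E) (extChartAt 𝓘(ℝ, E) (π x₀)) (π x) :=
    mdifferentiableAt_extChartAt hπx
  have h3 : HasMFDerivAt 𝓘(ℝ, F) 𝓘(ℝ, E) (p ∘ extChartAt 𝓘(ℝ, F) x₀) x
      (p.comp (mfderiv 𝓘(ℝ, F) 𝓘(ℝ, F) (extChartAt 𝓘(ℝ, F) x₀) x)) :=
    p.hasMFDerivAt.comp x h1.hasMFDerivAt
  have h4 : HasMFDerivAt 𝓘(ℝ, F) 𝓘(ℝ, E) (extChartAt 𝓘(ℝ, E) (π x₀) ∘ π) x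
      ((mfderiv 𝓘(ℝ, E) 𝓘(ℝ, E) (extChartAt 𝓘(ℝ, E) (π x₀)) (π x)).comp
        (mfderiv 𝓘(ℝ, F) 𝓘(ℝ, E) π x)) :=
    h2.hasMFDerivAt.comp x hπ.hasMFDerivAt
  -- Both sides are one map, differentiated in two ways; uniqueness of the derivative gives the
  -- claim.
  have h5 : p ∘ extChartAt 𝓘(ℝ, F) x₀ = extChartAt 𝓘(ℝ, E) (π x₀) ∘ π := funext hp
  rw [h5] at h3
  exact congrArg (fun A => A v) (hasMFDerivAt_unique h3 h4)

/-- Smoothness is tested in the trivialization at `x₀`, with fibre `Fin n → E`. There the `i`-th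
component is the trivialized field `X i` composed with the `i`-th projection. -/
theorem IsSmoothVectorFieldOn.productField {n : ℕ} {X : Fin n → ∀ x : M, Tan E x}
    (hX : ∀ i, IsSmoothVectorFieldOn (X i) Set.univ) :
    IsSmoothVectorFieldOn (productField X) Set.univ := by
  have : IsManifold 𝓘(ℝ, E) 1 M := .of_le (n := ∞) (by simp)
  have : IsManifold 𝓘(ℝ, Fin n → E) 1 (Fin n → M) := .of_le (n := ∞) (by simp)
  refine contMDiffOn_univ.2 fun x₀ => ?_
  refine (Bundle.contMDiffAt_section (IB := 𝓘(ℝ, Fin n → E)) (F := Fin n → E)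
    (E := TangentSpace 𝓘(ℝ, Fin n → E) (M := Fin n → M))
    (s := DiracGeometry.productField X) x₀).2 ?_
  refine contMDiffAt_pi_space.2 fun i => ?_
  have h := (Bundle.contMDiffAt_section (IB := 𝓘(ℝ, E)) (F := E)
    (E := TangentSpace 𝓘(ℝ, E) (M := M)) (s := X i) (x₀ i)).1
    (contMDiffOn_univ.1 (hX i) (x₀ i))
  refine (h.comp x₀ (contMDiff_eval i x₀)).congr_of_eventuallyEq ?_
  filter_upwards [chart_source_mem_nhds (Fin n → E) x₀] with x hx
  refine (map_trivializationAt_tangent_snd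
    (ContinuousLinearMap.proj (R := ℝ) (φ := fun _ : Fin n => E) i)
    (π := fun z : Fin n → M => z i) (x₀ := x₀) (fun z => rfl) hx (hx i (Set.mem_univ i))
    (hasMFDerivAt_eval i x).mdifferentiableAt (DiracGeometry.productField X x)).trans ?_
  rw [mfderiv_eval_productField]
  rfl

end PowerCalculus

/-! ### Differentials of real functions. -/

section Differentials

variable {E : Type*} [NormedAddCommGroup E] [NormedSpace ℝ E]
variable {M : Type*} [TopologicalSpace M] [ChartedSpace E M]

theorem diff_eq_of_hasMFDerivAt {f : M → ℝ} {x : M} {A : Tan E x →L[ℝ] ℝ}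
    (h : HasMFDerivAt 𝓘(ℝ, E) 𝓘(ℝ, ℝ) f x A) : diff E f x = A := by
  unfold diff mvfderiv
  rw [h.mfderiv]
  rfl

theorem IsSmoothFun.hasMFDerivAt_diff {f : M → ℝ} (hf : IsSmoothFun E f) (x : M) :
    HasMFDerivAt 𝓘(ℝ, E) 𝓘(ℝ, ℝ) f x (diff E f x) :=
  (ContMDiff.mdifferentiable hf (by simp) x).hasMFDerivAt

end Differentials

/-! ### Pull-backs of Casimir functions by a momentum map. -/

section CasimirPullback

variable {E : Type*} [NormedAddCommGroup E] [NormedSpace ℝ E]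
variable {M : Type*} [TopologicalSpace M] [ChartedSpace E M] [IsManifold 𝓘(ℝ, E) ∞ M]
variable {L : ∀ x : M, Submodule ℝ (Tan E x × Cotan E x)}
variable {𝔤 : Type*} [LieRing 𝔤] [LieAlgebra ℝ 𝔤]

/-- Two admissible functions Poisson-commute as soon as a Hamiltonian field of the first one
annihilates the second one. -/
theorem PoissonCommute.of_isHamiltonian (hL : ∀ x, IsIsotropic (L x)) {F G : M → ℝ}
    {X : ∀ x : M, Tan E x} (hX : IsHamiltonian L X F) (hG : G ∈ Adm L)
    (h : ∀ x, diff E G x (X x) = 0) : PoissonCommute L F G where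
  left_mem := ⟨X, hX⟩
  right_mem := hG
  bracket_eq_zero := by
    funext x
    rw [poissonBracket_eq hL hX hG, h, neg_zero, Pi.zero_apply]
  constant_of_motion Y hY x := by
    -- Isotropy makes `dF(Y) + dG(X)` vanish for every Hamiltonian field `Y` of `G`.
    have h1 := hL x _ (hX.mem x) _ (hY.mem x)
    have h2 := h x
    simp only [pairing] at h1
    linarith

theorem apply_dualDiff [FiniteDimensional ℝ 𝔤] (f : Module.Dual ℝ 𝔤 → ℝ)
    (ξ η : Module.Dual ℝ 𝔤) : η (dualDiff f ξ) = fderiv ℝ f ξ η := by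
  have h := (Module.evalEquiv ℝ 𝔤).apply_symm_apply (fderiv ℝ f ξ).toLinearMap
  exact congrArg (fun A : Module.Dual ℝ (Module.Dual ℝ 𝔤) => A η) h

/-- The linear function on `𝔤^*` defined by `v ∈ 𝔤`. -/
def dualEval [FiniteDimensional ℝ 𝔤] (v : 𝔤) : Module.Dual ℝ 𝔤 →L[ℝ] ℝ :=
  LinearMap.toContinuousLinearMap (Module.Dual.eval ℝ 𝔤 v)

theorem dualEval_apply [FiniteDimensional ℝ 𝔤] (v : 𝔤) (ξ : Module.Dual ℝ 𝔤) :
    dualEval v ξ = ξ v := rfl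

theorem dualDiff_dualEval [FiniteDimensional ℝ 𝔤] (v : 𝔤) (ξ : Module.Dual ℝ 𝔤) :
    dualDiff (dualEval v) ξ = v := by
  refine sub_eq_zero.1 ((Module.forall_dual_apply_eq_zero_iff ℝ _).1 fun η => ?_)
  rw [map_sub, apply_dualDiff, ContinuousLinearMap.fderiv, dualEval_apply, sub_self]

/-- It suffices to test the Casimir condition on the linear function of `v`, whose differential is
`v` at every point. -/
theorem IsCasimir.apply_lie_dualDiff [FiniteDimensional ℝ 𝔤] {C : Module.Dual ℝ 𝔤 → ℝ}
    (hC : IsCasimir C) (ξ : Module.Dual ℝ 𝔤) (v : 𝔤) : ξ ⁅dualDiff C ξ, v⁆ = 0 := by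
  have h := congrFun (hC.bracket_eq_zero (dualEval v) (dualEval v).contDiff) ξ
  rwa [kksBracket, dualDiff_dualEval] at h

namespace HamiltonianAction

variable (φ : HamiltonianAction 𝔤 L)

theorem isSmoothFun (v : 𝔤) : IsSmoothFun E (φ.toLinearMap v) := by
  obtain ⟨X, hX⟩ := φ.mem_adm v
  exact hX.smooth_fun

/-- In the dual basis the coordinates of `J_φ` are the functions `φ(b a)`; smoothness of `J_φ` is
read off from this. -/
theorem momentum_eq_sum {ι : Type*} [Fintype ι] (b : Module.Basis ι ℝ 𝔤) (x : M) :
    φ.momentum x = ∑ a, φ.toLinearMap (b a) x • b.coord a := by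
  refine b.ext fun c => ?_
  classical
  simp [momentum, Finsupp.single_apply]

variable [FiniteDimensional ℝ 𝔤]

theorem contMDiff_momentum :
    ContMDiff 𝓘(ℝ, E) 𝓘(ℝ, Module.Dual ℝ 𝔤) ∞ φ.momentum := by
  let b := Module.finBasis ℝ 𝔤
  have h : φ.momentum = fun x => ∑ a, φ.toLinearMap (b a) x • b.coord a :=
    funext (φ.momentum_eq_sum b)
  rw [h]
  exact contMDiff_finsetSum fun a _ => ContMDiff.smul (φ.isSmoothFun (b a)) contMDiff_const

/-- The differential of the momentum map. -/
def momentumDeriv (x : M) : Tan E x →L[ℝ] Module.Dual ℝ 𝔤 :=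
  mfderiv 𝓘(ℝ, E) 𝓘(ℝ, Module.Dual ℝ 𝔤) φ.momentum x

theorem diff_comp_momentum_apply {f : Module.Dual ℝ 𝔤 → ℝ} (hf : ContDiff ℝ ∞ f) (x : M)
    (t : Tan E x) :
    diff E (f ∘ φ.momentum) x t = φ.momentumDeriv x t (dualDiff f (φ.momentum x)) := by
  have hJ := ((φ.contMDiff_momentum).mdifferentiable (by simp) x).hasMFDerivAt
  have hf' : HasMFDerivAt 𝓘(ℝ, Module.Dual ℝ 𝔤) 𝓘(ℝ, ℝ) f (φ.momentum x)
      (fderiv ℝ f (φ.momentum x)) :=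
    (hf.differentiable (by simp) (φ.momentum x)).hasFDerivAt.hasMFDerivAt
  rw [apply_dualDiff]
  exact congrArg (fun A : Cotan E x => A t) (diff_eq_of_hasMFDerivAt (hf'.comp x hJ))

/-- The function `φ(v)` is the linear function of `v` composed with `J_φ`, so this is the chain
rule. -/
theorem diff_apply_eq_momentumDeriv (v : 𝔤) (x : M) (t : Tan E x) :
    diff E (φ.toLinearMap v) x t = φ.momentumDeriv x t v := by
  have h := φ.diff_comp_momentum_apply (dualEval v).contDiff x t
  rwa [dualDiff_dualEval] at h

/-- `d(C ∘ J_φ)_x = d(φ(dC_{J_φ(x)}))_x`. -/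
theorem diff_comp_momentum {C : Module.Dual ℝ 𝔤 → ℝ} (hC : ContDiff ℝ ∞ C) (x : M) :
    diff E (C ∘ φ.momentum) x = diff E (φ.toLinearMap (dualDiff C (φ.momentum x))) x := by
  ext t
  rw [diff_comp_momentum_apply φ hC, diff_apply_eq_momentumDeriv]

theorem diff_sum_smul {ι : Type*} [Fintype ι] (c : ι → ℝ) (w : ι → 𝔤) (x : M) :
    diff E (φ.toLinearMap (∑ a, c a • w a)) x = ∑ a, c a • diff E (φ.toLinearMap (w a)) x := by
  ext t
  rw [diff_apply_eq_momentumDeriv, map_sum, sum_apply]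
  simp only [map_smul, smul_apply, diff_apply_eq_momentumDeriv]

/-- The pull-back of a smooth function on `𝔤^*` by the momentum map has the `L`-Hamiltonian vector
field `∑ a, (∂C/∂ξ_a ∘ J_φ) X_a`, where `X_a` is a Hamiltonian vector field of `φ(e_a)`. -/
theorem isHamiltonian_comp_momentum {ι : Type*} [Fintype ι] (b : Module.Basis ι ℝ 𝔤)
    {X : ι → ∀ x : M, Tan E x} (hX : ∀ a, IsHamiltonian L (X a) (φ.toLinearMap (b a)))
    {C : Module.Dual ℝ 𝔤 → ℝ} (hC : ContDiff ℝ ∞ C) :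
    IsHamiltonian L (fun x => ∑ a, b.coord a (dualDiff C (φ.momentum x)) • X a x)
      (C ∘ φ.momentum) where
  smooth_fun := hC.contMDiff.comp φ.contMDiff_momentum
  smooth_field := by
    refine ContMDiffOn.sum_section fun a _ => ContMDiffOn.smul_section ?_ (hX a).smooth_field
    -- This coefficient is the derivative of `C` in the constant direction `b.coord a`.
    have h1 : ContDiff ℝ ∞ fun ξ => b.coord a (dualDiff C ξ) := by
      simp only [apply_dualDiff]
      exact (hC.fderiv_right (m := ∞) (by simp)).clm_apply contDiff_const
    exact (h1.contMDiff.comp φ.contMDiff_momentum).contMDiffOn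
  mem x := by
    have h : dualDiff C (φ.momentum x) =
        ∑ a, b.coord a (dualDiff C (φ.momentum x)) • b a := (b.sum_repr _).symm
    -- With `x` fixed the coefficients are constants. The rewrite by `h` also expands `dC` inside
    -- them, and `← h` folds it back.
    rw [φ.diff_comp_momentum hC, h, diff_sum_smul, ← h]
    have hs := (L x).sum_mem (t := Finset.univ) fun a _ =>
      (L x).smul_mem (b.coord a (dualDiff C (φ.momentum x))) ((hX a).mem x)
    convert hs using 1
    ext <;> simp [Prod.fst_sum, Prod.snd_sum]

/-- The pull-back of a Casimir function by the momentum map is a constant of motion. -/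
theorem poissonCommute_comp_momentum (hL : ∀ x, IsIsotropic (L x)) {C : Module.Dual ℝ 𝔤 → ℝ}
    (hC : IsCasimir C) (v : 𝔤) : PoissonCommute L (C ∘ φ.momentum) (φ.toLinearMap v) := by
  let b := Module.finBasis ℝ 𝔤
  choose X hX using fun a => φ.mem_adm (b a)
  refine .of_isHamiltonian hL (φ.isHamiltonian_comp_momentum b hX hC.smooth) (φ.mem_adm v)
    fun x => ?_
  -- This is the morphism property of `φ`, with the sign of `{f, g} = -X g`.
  have h1 : ∀ a, diff E (φ.toLinearMap v) x (X a x) = - φ.momentum x ⁅b a, v⁆ := by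
    intro a
    have h := congrFun (φ.map_lie (b a) v) x
    rw [poissonBracket_eq hL (hX a) (φ.mem_adm v)] at h
    exact neg_eq_iff_eq_neg.1 h.symm
  have h2 := hC.apply_lie_dualDiff (φ.momentum x) v
  rw [← b.sum_repr (dualDiff C (φ.momentum x))] at h2
  simp only [sum_lie, smul_lie, map_sum, map_smul, smul_eq_mul] at h2
  simp only [map_sum, map_smul, smul_eq_mul, h1, mul_neg, Finset.sum_neg_distrib, neg_eq_zero]
  exact h2

end HamiltonianAction
end CasimirPullback

/-! ### Hamiltonian fields, brackets and actions on `M ^ n`. -/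

section PowerActions

variable {E : Type*} [NormedAddCommGroup E] [NormedSpace ℝ E]
variable {M : Type*} [TopologicalSpace M] [ChartedSpace E M]

/-- The differential of the `i`-th projection `M ^ n → M`. -/
def evalDeriv {n : ℕ} (i : Fin n) (x : Fin n → M) : Tan (Fin n → E) x →L[ℝ] Tan E (x i) :=
  mfderiv 𝓘(ℝ, Fin n → E) 𝓘(ℝ, E) (fun z : Fin n → M => z i) x

theorem hasMFDerivAt_sum_eval {n : ℕ} {f : Fin n → M → ℝ} (hf : ∀ i, IsSmoothFun E (f i))
    (x : Fin n → M) :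
    HasMFDerivAt 𝓘(ℝ, Fin n → E) 𝓘(ℝ, ℝ) (fun z : Fin n → M => ∑ i, f i (z i)) x
      (∑ i, (diff E (f i) (x i)).comp (evalDeriv i x) : Tan (Fin n → E) x →L[ℝ] ℝ) := by
  have h (i : Fin n) : HasMFDerivAt 𝓘(ℝ, Fin n → E) 𝓘(ℝ, ℝ) (fun z : Fin n → M => f i (z i)) x
      ((diff E (f i) (x i)).comp (evalDeriv i x)) :=
    HasMFDerivAt.comp (f := fun z : Fin n → M => z i) x ((hf i).hasMFDerivAt_diff (x i))
      (hasMFDerivAt_eval i x).mdifferentiableAt.hasMFDerivAt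
  have hs := HasMFDerivAt.sum (t := Finset.univ) fun i _ => h i
  have hf' : (∑ i, fun z : Fin n → M => f i (z i)) = fun z => ∑ i, f i (z i) := by
    funext z
    simp
  rwa [hf'] at hs

/-- The right-hand side has the shape of the covectors in `prolongDirac`, so that membership in
`L^[n]` can be checked factor by factor. -/
theorem diff_sum_eval {n : ℕ} {f : Fin n → M → ℝ} (hf : ∀ i, IsSmoothFun E (f i))
    (x : Fin n → M) :
    diff (Fin n → E) (fun z : Fin n → M => ∑ i, f i (z i)) x =
      ∑ i, (diff E (f i) (x i)).comp (evalDeriv i x) :=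
  diff_eq_of_hasMFDerivAt (hasMFDerivAt_sum_eval hf x)

variable [IsManifold 𝓘(ℝ, E) ∞ M] {L : ∀ x : M, Submodule ℝ (Tan E x × Cotan E x)}
variable {𝔤 : Type*} [LieRing 𝔤] [LieAlgebra ℝ 𝔤]

theorem IsHamiltonian.productField {n : ℕ} {f : Fin n → M → ℝ} {X : Fin n → ∀ x : M, Tan E x}
    (h : ∀ i, IsHamiltonian L (X i) (f i)) :
    IsHamiltonian (prolongDirac L n) (productField X) (fun x => ∑ i, f i (x i)) where
  smooth_fun := contMDiff_finsetSum fun i _ =>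
    ContMDiff.comp (h i).smooth_fun (contMDiff_eval i)
  smooth_field := .productField fun i => (h i).smooth_field
  mem x := by
    refine ⟨fun i => diff E (f i) (x i), fun i => ?_,
      diff_sum_eval (fun i => (h i).smooth_fun) x⟩
    rw [mfderiv_eval_productField]
    exact (h i).mem (x i)

/-- The product of Hamiltonian fields of the `f i` is Hamiltonian for their sum, and its `i`-th
component differentiates only `g i`: there are no cross terms. -/
theorem poissonBracket_sum_eval (hL : ∀ x, IsIsotropic (L x)) {n : ℕ} {f g : Fin n → M → ℝ}
    (hf : ∀ i, f i ∈ Adm L) (hg : ∀ i, g i ∈ Adm L) (x : Fin n → M) :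
    poissonBracket (prolongDirac L n) (fun x => ∑ i, f i (x i)) (fun x => ∑ i, g i (x i)) x =
      ∑ i, poissonBracket L (f i) (g i) (x i) := by
  choose X hX using hf
  choose Y hY using hg
  rw [poissonBracket_eq (prolongDirac_isIsotropic hL n) (.productField hX)
    ⟨_, .productField hY⟩, diff_sum_eval (fun i => (hY i).smooth_fun),
    sum_apply, ← Finset.sum_neg_distrib]
  refine Finset.sum_congr rfl fun i _ => ?_
  rw [poissonBracket_eq hL (hX i) ⟨_, hY i⟩, ContinuousLinearMap.comp_apply, evalDeriv,
    mfderiv_eval_productField]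

/-- The action on `M ^ n` that is the sum of the actions `φ ∘ P i` on the factors, for Lie algebra
endomorphisms `P i`. -/
def HamiltonianAction.twistedProlong (φ : HamiltonianAction 𝔤 L) (hL : ∀ x, IsIsotropic (L x))
    {n : ℕ} (P : Fin n → 𝔤 →ₗ⁅ℝ⁆ 𝔤) : HamiltonianAction 𝔤 (prolongDirac L n) where
  toLinearMap :=
    { toFun := fun v x => ∑ i, φ.toLinearMap (P i v) (x i)
      map_add' := fun v w => by funext x; simp [Finset.sum_add_distrib]
      map_smul' := fun c v => by funext x; simp [Finset.mul_sum] }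
  mem_adm v := by
    choose X hX using fun i => φ.mem_adm (P i v)
    exact ⟨_, .productField hX⟩
  map_lie v w := by
    funext x
    refine Eq.trans ?_ (poissonBracket_sum_eval hL (fun i => φ.mem_adm (P i v))
      (fun i => φ.mem_adm (P i w)) x).symm
    simp only [← φ.map_lie, ← LieHom.map_lie]
    rfl

theorem HamiltonianAction.twistedProlong_apply (φ : HamiltonianAction 𝔤 L)
    (hL : ∀ x, IsIsotropic (L x)) {n : ℕ} (P : Fin n → 𝔤 →ₗ⁅ℝ⁆ 𝔤) (v : 𝔤) (x : Fin n → M) :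
    (φ.twistedProlong hL P).toLinearMap v x = ∑ i, φ.toLinearMap (P i v) (x i) := rfl

theorem HamiltonianAction.momentum_apply (φ : HamiltonianAction 𝔤 L) (x : M) (v : 𝔤) :
    φ.momentum x v = φ.toLinearMap v x := rfl

end PowerActions

/-! ### Iterated coproducts and coactions as pull-backs by sums; the projection onto `𝔥`. -/

section IteratedMaps

variable {𝔤 : Type*} [LieRing 𝔤] [LieAlgebra ℝ 𝔤]
variable {𝔥 : LieSubalgebra ℝ 𝔤} {𝔭 : LieIdeal ℝ 𝔤}

theorem iterCoproduct_succ_apply (k : ℕ) (f : Module.Dual ℝ 𝔤 → ℝ)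
    (ξ : Fin (k + 1) → Module.Dual ℝ 𝔤) : iterCoproduct (k + 1) f ξ = f (∑ i, ξ i) := by
  induction k with
  | zero => simp [iterCoproduct]
  | succ k ih =>
    -- The induction hypothesis is applied to the tuple whose last two entries have been added
    -- together.
    refine (ih _).trans ?_
    rw [Fin.sum_univ_castSucc (n := k + 1), Fin.sum_univ_castSucc (n := k),
      Fin.sum_univ_castSucc (n := k)]
    simp [add_assoc]

theorem iterCoaction_succ_apply (hc : IsCompl 𝔥.toSubmodule 𝔭.toSubmodule) (s : ℕ)
    (f : Module.Dual ℝ 𝔤 → ℝ) (q : Module.Dual ℝ 𝔤 × (Fin s → Module.Dual ℝ 𝔥)) :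
    iterCoaction hc (s + 1) f q = f (q.1 + ∑ j, dualIncl hc (q.2 j)) := by
  induction s generalizing f with
  | zero => simp [iterCoaction]
  | succ s ih =>
    -- The outermost coaction absorbs the `𝔥^*` variable of index `0` into the `𝔤^*` variable.
    refine (ih _ _).trans ?_
    rw [Fin.sum_univ_succ, add_assoc]

/-- The projection of `𝔤 = 𝔥 ⊕ 𝔭` onto `𝔥` along the ideal `𝔭`, as an endomorphism of `𝔤`. -/
def projLieHom (hc : IsCompl 𝔥.toSubmodule 𝔭.toSubmodule) : 𝔤 →ₗ⁅ℝ⁆ 𝔤 :=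
  { 𝔥.toSubmodule.subtype ∘ₗ Submodule.projectionOnto 𝔥.toSubmodule 𝔭.toSubmodule hc with
    map_lie' := by
      intro v w
      set p := Submodule.projectionOnto 𝔥.toSubmodule 𝔭.toSubmodule hc with hp
      have hmem (u : 𝔤) : u - p u ∈ 𝔭 := by
        refine (Submodule.projectionOnto_apply_eq_zero_iff hc).1 ?_
        rw [map_sub, Submodule.projectionOnto_apply_left, sub_self]
      -- The ideal `𝔭` absorbs both terms of the telescoped difference, so `p` does not see it.
      have h1 : ⁅v, w⁆ - ⁅(p v : 𝔤), (p w : 𝔤)⁆ ∈ 𝔭 := by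
        have : ⁅v, w⁆ - ⁅(p v : 𝔤), (p w : 𝔤)⁆ = ⁅v - p v, w⁆ + ⁅(p v : 𝔤), w - p w⁆ := by
          simp
        rw [this]
        exact add_mem (lie_mem_left ℝ 𝔤 𝔭 _ _ (hmem v)) (lie_mem_right ℝ 𝔤 𝔭 _ _ (hmem w))
      have h2 : p ⁅v, w⁆ = p ⁅(p v : 𝔤), (p w : 𝔤)⁆ :=
        sub_eq_zero.1 ((map_sub p _ _).symm.trans
          ((Submodule.projectionOnto_apply_eq_zero_iff hc).2 h1))
      -- `𝔥` is closed under brackets and `p` is the identity on it.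
      have h3 : p ⁅(p v : 𝔤), (p w : 𝔤)⁆ = ⟨_, 𝔥.lie_mem (p v).2 (p w).2⟩ :=
        Submodule.projectionOnto_apply_left hc ⟨_, 𝔥.lie_mem (p v).2 (p w).2⟩
      exact congrArg Subtype.val (h2.trans h3) }

theorem projLieHom_of_mem_left (hc : IsCompl 𝔥.toSubmodule 𝔭.toSubmodule) {v : 𝔤} (hv : v ∈ 𝔥) :
    projLieHom hc v = v :=
  congrArg Subtype.val (Submodule.projectionOnto_apply_left hc ⟨v, hv⟩)

theorem projLieHom_of_mem_right (hc : IsCompl 𝔥.toSubmodule 𝔭.toSubmodule) {u : 𝔤} (hu : u ∈ 𝔭) :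
    projLieHom hc u = 0 :=
  congrArg Subtype.val ((Submodule.projectionOnto_apply_eq_zero_iff hc).2 hu)

/-- The identity on the first `r` indices, and the projection onto `𝔥` on the others. -/
def mixedLieHom (hc : IsCompl 𝔥.toSubmodule 𝔭.toSubmodule) (r : ℕ) {n : ℕ} (i : Fin n) :
    𝔤 →ₗ⁅ℝ⁆ 𝔤 :=
  if (i : ℕ) < r then LieHom.id else projLieHom hc

theorem mixedLieHom_of_mem_left (hc : IsCompl 𝔥.toSubmodule 𝔭.toSubmodule) (r : ℕ) {n : ℕ}
    (i : Fin n) {v : 𝔤} (hv : v ∈ 𝔥) : mixedLieHom hc r i v = v := by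
  unfold mixedLieHom
  split_ifs
  · rfl
  · exact projLieHom_of_mem_left hc hv

theorem sum_cast {A : Type*} [AddCommMonoid A] {r s n : ℕ} (h : r + s = n) (F : Fin n → A) :
    ∑ i, F i = ∑ i : Fin r, F (Fin.cast h (Fin.castAdd s i)) +
      ∑ j : Fin s, F (Fin.cast h (Fin.natAdd r j)) := by
  subst h
  exact Fin.sum_univ_add F

theorem mixedLieHom_castAdd (hc : IsCompl 𝔥.toSubmodule 𝔭.toSubmodule) {r s n : ℕ}
    (h : r + s = n) (i : Fin r) (v : 𝔤) :
    mixedLieHom hc r (Fin.cast h (Fin.castAdd s i)) v = v := by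
  rw [mixedLieHom, if_pos (by simp)]
  rfl

theorem mixedLieHom_natAdd (hc : IsCompl 𝔥.toSubmodule 𝔭.toSubmodule) {r s n : ℕ}
    (h : r + s = n) (j : Fin s) :
    mixedLieHom hc r (Fin.cast h (Fin.natAdd r j)) = projLieHom hc := by
  rw [mixedLieHom, if_neg (by simp)]

end IteratedMaps

/-! ### The mixed action on `M ^ n` and its momentum map. -/

section MixedAction

variable {E : Type*} [NormedAddCommGroup E] [NormedSpace ℝ E]
variable {M : Type*} [TopologicalSpace M] [ChartedSpace E M] [IsManifold 𝓘(ℝ, E) ∞ M]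
variable {L : ∀ x : M, Submodule ℝ (Tan E x × Cotan E x)}
variable {𝔤 : Type*} [LieRing 𝔤] [LieAlgebra ℝ 𝔤]
variable {𝔥 : LieSubalgebra ℝ 𝔤} {𝔭 : LieIdeal ℝ 𝔤}

namespace HamiltonianAction

variable (φ : HamiltonianAction 𝔤 L) (hL : ∀ x, IsIsotropic (L x))
variable (hc : IsCompl 𝔥.toSubmodule 𝔭.toSubmodule) {r s n : ℕ}

/-- The action on `M ^ n` of `𝔤` on the first `r` factors and of `𝔥 ≃ 𝔤 / 𝔭` on the others. -/
def mixedProlong (r n : ℕ) : HamiltonianAction 𝔤 (prolongDirac L n) :=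
  φ.twistedProlong hL fun i => mixedLieHom hc r i

theorem mixedProlong_of_mem_left {v : 𝔤} (hv : v ∈ 𝔥) :
    (φ.mixedProlong hL hc r n).toLinearMap v = prolongFun n (φ.toLinearMap v) := by
  funext x
  simp only [mixedProlong, twistedProlong_apply, mixedLieHom_of_mem_left hc r _ hv, prolongFun]

theorem mixedProlong_apply (h : r + s = n) (v : 𝔤) (x : Fin n → M) :
    (φ.mixedProlong hL hc r n).toLinearMap v x =
      ∑ i : Fin r, φ.toLinearMap v (x (Fin.cast h (Fin.castAdd s i))) +
        ∑ j : Fin s, φ.toLinearMap (projLieHom hc v) (x (Fin.cast h (Fin.natAdd r j))) := by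
  rw [mixedProlong, twistedProlong_apply, sum_cast h]
  simp only [mixedLieHom_castAdd, mixedLieHom_natAdd]

theorem mixedProlong_of_mem_right (h : r + s = n) {u : 𝔤} (hu : u ∈ 𝔭) (x : Fin n → M) :
    (φ.mixedProlong hL hc r n).toLinearMap u x =
      ∑ i : Fin r, φ.toLinearMap u (x (Fin.cast h (Fin.castAdd s i))) := by
  rw [φ.mixedProlong_apply hL hc h, projLieHom_of_mem_right hc hu]
  simp

/-- Precomposing a functional on `𝔥` with the projection is exactly `dualIncl`, so both sides agree
on each `v`, term by term. -/
theorem mixedProlong_momentum (h : r + s = n) (x : Fin n → M) :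
    (φ.mixedProlong hL hc r n).momentum x =
      ∑ i, (φ.productMomentum 𝔥 h x).1 i + ∑ j, dualIncl hc ((φ.productMomentum 𝔥 h x).2 j) := by
  ext v
  rw [momentum_apply, φ.mixedProlong_apply hL hc h, LinearMap.add_apply, LinearMap.sum_apply,
    LinearMap.sum_apply]
  rfl

theorem coactionFun_eq (C : Module.Dual ℝ 𝔤 → ℝ) (ℓ : ℕ) (hℓ : 2 ≤ ℓ) :
    coactionFun hc φ C ℓ hℓ = C ∘ (φ.mixedProlong hL hc 1 ℓ).momentum := by
  funext x
  -- Writing `ℓ = s + 1` makes the truncated `ℓ - 1` reduce to `s` by definition.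
  obtain ⟨s, rfl⟩ : ∃ s, ℓ = s + 1 := ⟨ℓ - 1, by omega⟩
  rw [coactionFun, Function.comp_apply, φ.mixedProlong_momentum hL hc (Nat.add_comm 1 s)]
  refine (iterCoaction_succ_apply hc s C _).trans ?_
  rw [Fin.sum_univ_one]

theorem coproductCoactionFun_eq (C : Module.Dual ℝ 𝔤 → ℝ) (k ℓ : ℕ) (hk : k ≠ 0) (hℓ : 2 ≤ ℓ) :
    coproductCoactionFun hc φ C k ℓ hℓ = C ∘ (φ.mixedProlong hL hc k (k + ℓ - 1)).momentum := by
  funext x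
  obtain ⟨s, rfl⟩ : ∃ s, ℓ = s + 1 := ⟨ℓ - 1, by omega⟩
  obtain ⟨k, rfl⟩ : ∃ k', k = k' + 1 := Nat.exists_eq_succ_of_ne_zero hk
  rw [coproductCoactionFun, Function.comp_apply, iterCoproductTensorId, iterCoproduct_succ_apply,
    φ.mixedProlong_momentum hL hc (show k + 1 + s = k + 1 + (s + 1) - 1 by omega)]
  exact iterCoaction_succ_apply hc s C _

end HamiltonianAction
end MixedAction

end DiracGeometry

end

theorem mainTheorem7
    {E : Type*} [NormedAddCommGroup E] [NormedSpace ℝ E] [FiniteDimensional ℝ E]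
    {M : Type*} [TopologicalSpace M] [T2Space M] [ParacompactSpace M]
    [TopologicalSpace.SeparableSpace M] [ChartedSpace E M] [IsManifold 𝓘(ℝ, E) ∞ M]
    (L : ∀ x : M, Submodule ℝ (Tan E x × Cotan E x)) (hL : IsDirac L)
    {𝔤 : Type*} [LieRing 𝔤] [LieAlgebra ℝ 𝔤] [FiniteDimensional ℝ 𝔤]
    (𝔥 : LieSubalgebra ℝ 𝔤) (𝔭 : LieIdeal ℝ 𝔤) (hc : IsCompl 𝔥.toSubmodule 𝔭.toSubmodule)
    (φ : HamiltonianAction 𝔤 L)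
    (C : Module.Dual ℝ 𝔤 → ℝ) (hC : IsCasimir C) :
    (∀ (ℓ : ℕ) (hℓ : 2 ≤ ℓ),
      (∀ v ∈ 𝔥, PoissonCommute (prolongDirac L ℓ) (coactionFun hc φ C ℓ hℓ)
        (prolongFun ℓ (φ.toLinearMap v))) ∧
      (∀ u ∈ 𝔭, PoissonCommute (prolongDirac L ℓ) (coactionFun hc φ C ℓ hℓ)
        (fun x => φ.toLinearMap u (x ⟨0, by omega⟩)))) ∧
    (∀ (k ℓ : ℕ) (hk : 2 ≤ k) (hℓ : 2 ≤ ℓ),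
      (∀ v ∈ 𝔥, PoissonCommute (prolongDirac L (k + ℓ - 1)) (coproductCoactionFun hc φ C k ℓ hℓ)
        (prolongFun (k + ℓ - 1) (φ.toLinearMap v))) ∧
      (∀ u ∈ 𝔭, PoissonCommute (prolongDirac L (k + ℓ - 1)) (coproductCoactionFun hc φ C k ℓ hℓ)
        (liftFun (show k ≤ k + ℓ - 1 by omega) (prolongFun k (φ.toLinearMap u))))) := by

  have hiso : ∀ x, IsIsotropic (L x) := fun x => (hL.maximal_isotropic x).prop
  -- The mixed action has `r = 1`, `n = ℓ` in the first two goals and `r = k`, `n = k + ℓ - 1` in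
  -- the last two.
  refine ⟨fun ℓ hℓ => ⟨fun v hv => ?_, fun u hu => ?_⟩,
    fun k ℓ hk hℓ => ⟨fun v hv => ?_, fun u hu => ?_⟩⟩
  · rw [φ.coactionFun_eq hiso hc, ← φ.mixedProlong_of_mem_left hiso hc (r := 1) hv]
    exact (φ.mixedProlong hiso hc 1 ℓ).poissonCommute_comp_momentum
      (prolongDirac_isIsotropic hiso ℓ) hC v
  · have h : (fun x : Fin ℓ → M => φ.toLinearMap u (x ⟨0, by omega⟩)) =
        (φ.mixedProlong hiso hc 1 ℓ).toLinearMap u := by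
      funext x
      rw [φ.mixedProlong_of_mem_right hiso hc (show 1 + (ℓ - 1) = ℓ by omega) hu,
        Fin.sum_univ_one]
      rfl
    rw [φ.coactionFun_eq hiso hc, h]
    exact (φ.mixedProlong hiso hc 1 ℓ).poissonCommute_comp_momentum
      (prolongDirac_isIsotropic hiso ℓ) hC u
  · rw [φ.coproductCoactionFun_eq hiso hc C k ℓ (by omega),
      ← φ.mixedProlong_of_mem_left hiso hc (r := k) hv]
    exact (φ.mixedProlong hiso hc k (k + ℓ - 1)).poissonCommute_comp_momentum
      (prolongDirac_isIsotropic hiso _) hC v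
  · have h : liftFun (show k ≤ k + ℓ - 1 by omega) (prolongFun k (φ.toLinearMap u)) =
        (φ.mixedProlong hiso hc k (k + ℓ - 1)).toLinearMap u := by
      funext x
      rw [φ.mixedProlong_of_mem_right hiso hc (show k + (ℓ - 1) = k + ℓ - 1 by omega) hu]
      rfl
    rw [φ.coproductCoactionFun_eq hiso hc C k ℓ (by omega), h]
    exact (φ.mixedProlong hiso hc k (k + ℓ - 1)).poissonCommute_comp_momentum
      (prolongDirac_isIsotropic hiso _) hC u
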